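/- Let $\kappa$ be an inaccessible cardinal, let $M = V_\kappa$, and let $\mathcal X \subseteq \mathcal P(M)$ be such that $(M,\mathcal X) \models \mathsf{GB}$. Here $\mathsf{GB}$ is Gödel--Bernays class theory without global choice: $\mathsf{ZFC}$ for the sets, extensionality and replacement for classes, and comprehension for formulas that quantify only over sets (set and class parameters allowed). Let $C$ be a class of ordinals of $M$ that is Cohen-generic over $(M,\mathcal X)$: for every $D \in \mathcal X$ that is a dense class of conditions of $\mathrm{Add}(\mathrm{Ord},1)^M$ (the binary sequences of ordinal length in $M$, ordered by end-extension), some element of $D$ is an initial segment of the characteristic function of $C$. Then there is $\mathcal Y \subseteq \mathcal P(M)$ with $\mathcal X \subseteq \mathcal Y$ and $C \in \mathcal Y$ such that 1. $(M,\mathcal Y) \models \mathsf{GB}$; 2. for every $A \in \mathcal X$, the truth predicate $\mathrm{Tr}(A)$ of $M$ relative to $A$ is in $\mathcal Y$; 3. for every $A \in \mathcal X$ and every class well-order $\xi \in \mathcal X$, the $\xi$-iterated truth predicate $\mathrm{Tr}_\xi(A)$ of $M$ relative to $A$ is in $\mathcal Y$; 4. $(M,\mathcal Y)$ is an elementary submodel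 of $(M,\mathcal P(M))$ in the two-sorted language of class theory, and $|\mathcal Y| = |\mathcal X|$. Here $\mathrm{Tr}(A)$ is the class of pairs $(\varphi,a)$, with $\varphi$ a (code of a) first-order formula in the language with $\in$ and a unary predicate for $A$ and $a$ a finite sequence from $M$, that satisfies the Tarskian truth conditions for $(M,\in,A)$. The predicate $\mathrm{Tr}_\xi(A)$ is the class $\Theta$ of triples $(\eta,\varphi,a)$, with $\eta \in \operatorname{dom}(\xi)$ and with $\varphi$ a formula in this language expanded by a ternary predicate symbol $\hat\Theta$, that satisfies the Tarskian truth conditions for $(M,\in,A)$ at each level $\eta$, together with the clause: at level $\eta$ the formula $\hat\Theta(x,y,z)$ holds of $(\zeta,\psi,b)$ if and only if $\zeta <_\xi \eta$ and $(\zeta,\psi,b) \in \Theta$. -/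

import Mathlib

universe u

/-!
Class theory over a transitive set `M`.  A model of class theory is a pair `(M, X)`, where the sets
are the elements of the `ZFSet` `M`, the classes are the elements of `X` (each of them a subset of
`M`, hence again a `ZFSet`), and membership is true membership.
-/

namespace ClassTheory

open FirstOrder

/-! ### The two-sorted language of class theory and its elementary formulas -/

/-- The relation symbols of the language of class theory: a unary predicate singling out the sort of
sets (the other objects are the classes), and binary membership. -/
inductive ClassRel : ℕ → Type
  | isSet : ClassRel 1
  | mem : ClassRel 2

/-- The two-sorted language of class theory, rendered with a predicate for the sort of sets. -/
def classLang : FirstOrder.Language.{0, 0} := ⟨fun _ => Empty, ClassRel⟩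

/-- The universe of the two-sorted structure `(M, X)`: the sets, together with the classes. -/
def Carrier (M : ZFSet.{u}) (X : Set ZFSet.{u}) : Type (u + 1) :=
  {x : ZFSet.{u} // x ∈ M} ⊕ {A : ZFSet.{u} // A ∈ X}

namespace Carrier

variable {M : ZFSet.{u}} {X Y : Set ZFSet.{u}}

/-- A set, as an object of `(M, X)`. -/
def ofSet (x : ZFSet.{u}) (hx : x ∈ M) : Carrier M X := Sum.inl ⟨x, hx⟩

/-- A class, as an object of `(M, X)`. -/
def ofClass (A : ZFSet.{u}) (hA : A ∈ X) : Carrier M X := Sum.inr ⟨A, hA⟩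

/-- The objects of the sort of sets. -/
def IsSet : Carrier M X → Prop
  | Sum.inl _ => True
  | Sum.inr _ => False

/-- True membership, of sets in sets and of sets in classes. -/
def Mem : Carrier M X → Carrier M X → Prop
  | Sum.inl x, Sum.inl y => x.1 ∈ y.1
  | Sum.inl x, Sum.inr A => x.1 ∈ A.1
  | Sum.inr _, _ => False

instance : classLang.Structure (Carrier M X) where
  funMap := fun f => Empty.elim f
  RelMap := fun r v => match r, v with
    | ClassRel.isSet, v => IsSet (v 0)
    | ClassRel.mem, v => Mem (v 0) (v 1)

/-- The inclusion of `(M, X)` into `(M, Y)` when `X ⊆ Y`. -/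
def incl (h : X ⊆ Y) : Carrier M X → Carrier M Y
  | Sum.inl x => Sum.inl x
  | Sum.inr A => Sum.inr ⟨A.1, h A.2⟩

end Carrier

/-- The elementary formulas of class theory: all quantifiers range over sets only (free variables
may stand for sets or for classes). -/
inductive IsElementary {α : Type} : ∀ {n : ℕ}, classLang.BoundedFormula α n → Prop
  | falsum {n : ℕ} :
      IsElementary (FirstOrder.Language.BoundedFormula.falsum (L := classLang) (α := α) (n := n))
  | equal {n : ℕ} (s t : classLang.Term (α ⊕ Fin n)) :
      IsElementary (FirstOrder.Language.BoundedFormula.equal s t)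
  | rel {n l : ℕ} (R : classLang.Relations l) (ts : Fin l → classLang.Term (α ⊕ Fin n)) :
      IsElementary (FirstOrder.Language.BoundedFormula.rel R ts)
  | imp {n : ℕ} {φ ψ : classLang.BoundedFormula α n} :
      IsElementary φ → IsElementary ψ → IsElementary (φ.imp ψ)
  | allSets {n : ℕ} {φ : classLang.BoundedFormula α (n + 1)} :
      IsElementary φ →
      IsElementary (FirstOrder.Language.BoundedFormula.all
        (FirstOrder.Language.BoundedFormula.imp
          (FirstOrder.Language.BoundedFormula.rel (L := classLang) ClassRel.isSet
            (fun _ => FirstOrder.Language.Term.var (Sum.inr (Fin.last n)))) φ))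

/-- `(M, Y)` is an elementary submodel of `(M, Z)`, for the full language of class theory (formulas
may quantify over sets and over classes). -/
def IsElementarySubmodel (M : ZFSet.{u}) (Y Z : Set ZFSet.{u}) : Prop :=
  ∃ (h : Y ⊆ Z) (f : Carrier M Y ↪ₑ[classLang] Carrier M Z), ⇑f = Carrier.incl h

/-- All subsets of `M`, as classes over `M`. -/
def fullClasses (M : ZFSet.{u}) : Set ZFSet.{u} := {A | A ⊆ M}

/-! ### Gödel–Bernays class theory -/

/-- `(M, X) ⊨ GB`, for a transitive set `M` and a collection `X` of subsets of `M`: the axioms of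
`ZFC` for the sets, extensionality and replacement for classes, and comprehension for elementary
formulas (with set and class parameters).  The separation and replacement schemes for sets are the
instances of class replacement for classes given by elementary comprehension.  No global choice. -/
structure IsGBModel (M : ZFSet.{u}) (X : Set ZFSet.{u}) : Prop where
  transitive : M.IsTransitive
  class_subset : ∀ A ∈ X, A ⊆ M
  extensionality : ∀ x ∈ M, ∀ y ∈ M, (∀ z ∈ M, z ∈ x ↔ z ∈ y) → x = y
  foundation : ∀ x ∈ M, (∃ y ∈ M, y ∈ x) → ∃ y ∈ M, y ∈ x ∧ ∀ z ∈ M, z ∈ y → z ∉ x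
  pairing : ∀ x ∈ M, ∀ y ∈ M, ∃ p ∈ M, ∀ z ∈ M, z ∈ p ↔ z = x ∨ z = y
  union : ∀ x ∈ M, ∃ s ∈ M, ∀ z ∈ M, z ∈ s ↔ ∃ y ∈ M, y ∈ x ∧ z ∈ y
  powerset : ∀ x ∈ M, ∃ p ∈ M, ∀ z ∈ M, z ∈ p ↔ ∀ w ∈ M, w ∈ z → w ∈ x
  infinity : ∃ w ∈ M, (∃ e ∈ M, e ∈ w ∧ ∀ z ∈ M, z ∉ e) ∧
    ∀ x ∈ M, x ∈ w → ∃ s ∈ M, s ∈ w ∧ ∀ z ∈ M, z ∈ s ↔ z ∈ x ∨ z = x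
  choice : ∀ x ∈ M, (∀ y ∈ M, y ∈ x → ∃ z ∈ M, z ∈ y) →
    (∀ y ∈ M, ∀ y' ∈ M, y ∈ x → y' ∈ x → y ≠ y' → ∀ z ∈ M, ¬ (z ∈ y ∧ z ∈ y')) →
    ∃ c ∈ M, ∀ y ∈ M, y ∈ x → ∃! z, z ∈ M ∧ z ∈ y ∧ z ∈ c
  class_extensionality : ∀ A ∈ X, ∀ B ∈ X, (∀ x ∈ M, x ∈ A ↔ x ∈ B) → A = B
  class_replacement : ∀ F ∈ X,
    (∀ x ∈ M, ∀ y ∈ M, ∀ y' ∈ M, ZFSet.pair x y ∈ F → ZFSet.pair x y' ∈ F → y = y') →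
    ∀ a ∈ M, ∃ b ∈ M, ∀ y ∈ M, y ∈ b ↔ ∃ x ∈ M, x ∈ a ∧ ZFSet.pair x y ∈ F
  comprehension : ∀ (n : ℕ) (φ : classLang.BoundedFormula (Fin n) 1), IsElementary φ →
    ∀ v : Fin n → Carrier M X, ∃ A ∈ X, ∀ (x : ZFSet.{u}) (hx : x ∈ M),
      x ∈ A ↔ φ.Realize v (fun _ => Carrier.ofSet x hx)

/-! ### Cohen-generic classes of ordinals -/

/-- The conditions of `Add(Ord, 1)` as computed in `M`: the functions in `M` from an ordinal to
`2 = {0, 1}`.  A condition `q` is stronger than `p` if `p ⊆ q`. -/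
def IsCohenCondition (M p : ZFSet.{u}) : Prop :=
  p ∈ M ∧ ∃ α : ZFSet.{u}, α.IsOrdinal ∧ ZFSet.IsFunc α {∅, {∅}} p

/-- `D` is a dense class of conditions of `Add(Ord, 1)`. -/
def IsDenseClass (M D : ZFSet.{u}) : Prop :=
  (∀ p ∈ D, IsCohenCondition M p) ∧
    ∀ p, IsCohenCondition M p → ∃ q ∈ D, p ⊆ q

/-- The condition `p` is an initial segment of the characteristic function of `C`. -/
def IsInitialSegmentOf (p C : ZFSet.{u}) : Prop :=
  ∀ a i : ZFSet.{u}, ZFSet.pair a i ∈ p → (i = {∅} ↔ a ∈ C)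

/-- `C` is a class of ordinals of `M` that is Cohen-generic over `(M, X)`: the filter of the
conditions that are initial segments of (the characteristic function of) `C` meets every dense class
in `X`. -/
def IsCohenGeneric (M : ZFSet.{u}) (X : Set ZFSet.{u}) (C : ZFSet.{u}) : Prop :=
  (∀ a ∈ C, a ∈ M ∧ a.IsOrdinal) ∧
    ∀ D ∈ X, IsDenseClass M D → ∃ p ∈ D, IsInitialSegmentOf p C

/-! ### Class well-orders -/

/-- `x` is in the domain of the (reflexive) order `Γ`. -/
def InDom (Γ x : ZFSet.{u}) : Prop := ZFSet.pair x x ∈ Γ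

/-- The strict part of the order `Γ`. -/
def StrictLT (Γ x y : ZFSet.{u}) : Prop := ZFSet.pair x y ∈ Γ ∧ x ≠ y

/-- `Γ`, a class of ordered pairs over `M`, is (the reflexive form `≤` of) a well-order in the sense
of `M`: it is a linear order of its domain, and every nonempty set in `M` of elements of the domain
has a least element. -/
structure IsClassWellOrder (M Γ : ZFSet.{u}) : Prop where
  subset : Γ ⊆ M
  pairs : ∀ t ∈ Γ, ∃ x y : ZFSet.{u}, t = ZFSet.pair x y
  refl : ∀ x y : ZFSet.{u}, ZFSet.pair x y ∈ Γ → InDom Γ x ∧ InDom Γ y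
  antisymm : ∀ x y : ZFSet.{u}, ZFSet.pair x y ∈ Γ → ZFSet.pair y x ∈ Γ → x = y
  trans : ∀ x y z : ZFSet.{u}, ZFSet.pair x y ∈ Γ → ZFSet.pair y z ∈ Γ → ZFSet.pair x z ∈ Γ
  total : ∀ x y : ZFSet.{u}, InDom Γ x → InDom Γ y → ZFSet.pair x y ∈ Γ ∨ ZFSet.pair y x ∈ Γ
  least : ∀ s ∈ M, s ≠ ∅ → (∀ x ∈ s, InDom Γ x) → ∃ m ∈ s, ∀ x ∈ s, ZFSet.pair m x ∈ Γ

/-! ### Truth predicates and iterated truth predicates -/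

/-- First-order formulas in the free variables `v₀, …, vₙ₋₁`, in the language with `∈`, `=` and a
unary predicate symbol for a class.  If `θ` holds, then the language has in addition the ternary
predicate symbol `Θ̂`.  In `all φ` the quantified variable is `vₙ`. -/
inductive Fml (θ : Prop) : ℕ → Type
  | falsum {n : ℕ} : Fml θ n
  | mem {n : ℕ} (i j : Fin n) : Fml θ n
  | eq {n : ℕ} (i j : Fin n) : Fml θ n
  | cls {n : ℕ} (i : Fin n) : Fml θ n
  | tr {n : ℕ} (h : θ) (i j k : Fin n) : Fml θ n
  | imp {n : ℕ} (φ ψ : Fml θ n) : Fml θ n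
  | all {n : ℕ} (φ : Fml θ (n + 1)) : Fml θ n

/-- The von Neumann numeral `n`. -/
noncomputable def num (n : ℕ) : ZFSet.{u} := Ordinal.toZFSet (n : Ordinal.{u})

/-- Ordered triples `(x, y, z)`. -/
def triple (x y z : ZFSet.{u}) : ZFSet.{u} := ZFSet.pair x (ZFSet.pair y z)

/-- The Gödel code of a formula, a hereditarily finite set. -/
noncomputable def Fml.code {θ : Prop} : ∀ {n : ℕ}, Fml θ n → ZFSet.{u}
  | _, .falsum => ZFSet.pair (num 0) (num 0)
  | _, .mem i j => ZFSet.pair (num 1) (ZFSet.pair (num i) (num j))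
  | _, .eq i j => ZFSet.pair (num 2) (ZFSet.pair (num i) (num j))
  | _, .cls i => ZFSet.pair (num 3) (num i)
  | _, .tr _ i j k => ZFSet.pair (num 4) (triple (num i) (num j) (num k))
  | _, .imp φ ψ => ZFSet.pair (num 5) (ZFSet.pair φ.code ψ.code)
  | n, .all φ => ZFSet.pair (num 6) (ZFSet.pair (num n) φ.code)

/-- The finite sequence `⟨a₀, …, aₙ₋₁⟩` as a set: the function `i ↦ aᵢ` on the numeral `n`. -/
noncomputable def tuple {n : ℕ} (a : Fin n → ZFSet.{u}) : ZFSet.{u} :=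
  ZFSet.range fun i : Fin n => ZFSet.pair (num i) (a i)

/-- The Tarskian truth conditions for `(M, ∈, A)`, for a satisfaction relation `S` on formulas and
finite sequences from `M`.  The relation `T` interprets the symbol `Θ̂`, if it is in the language. -/
structure TarskiConditions (M A : ZFSet.{u}) (θ : Prop)
    (S : ∀ n : ℕ, Fml θ n → (Fin n → ZFSet.{u}) → Prop)
    (T : ZFSet.{u} → ZFSet.{u} → ZFSet.{u} → Prop) : Prop where
  falsum : ∀ (n : ℕ) (a : Fin n → ZFSet.{u}), (∀ i, a i ∈ M) → ¬ S n .falsum a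
  mem : ∀ (n : ℕ) (a : Fin n → ZFSet.{u}), (∀ i, a i ∈ M) → ∀ i j,
    S n (.mem i j) a ↔ a i ∈ a j
  eq : ∀ (n : ℕ) (a : Fin n → ZFSet.{u}), (∀ i, a i ∈ M) → ∀ i j,
    S n (.eq i j) a ↔ a i = a j
  cls : ∀ (n : ℕ) (a : Fin n → ZFSet.{u}), (∀ i, a i ∈ M) → ∀ i,
    S n (.cls i) a ↔ a i ∈ A
  tr : ∀ (n : ℕ) (a : Fin n → ZFSet.{u}), (∀ i, a i ∈ M) → ∀ (h : θ) (i j k),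
    S n (.tr h i j k) a ↔ T (a i) (a j) (a k)
  imp : ∀ (n : ℕ) (a : Fin n → ZFSet.{u}), (∀ i, a i ∈ M) → ∀ φ ψ,
    S n (.imp φ ψ) a ↔ (S n φ a → S n ψ a)
  all : ∀ (n : ℕ) (a : Fin n → ZFSet.{u}), (∀ i, a i ∈ M) → ∀ φ,
    S n (.all φ) a ↔ ∀ b ∈ M, S (n + 1) φ (Fin.snoc (α := fun _ => ZFSet.{u}) a b)

/-- `T` is the truth predicate `Tr(A)` of `M` relative to the class `A`: a class of pairs
`(φ, a)`, with `φ` a formula in the language with `∈` and a predicate for `A` and `a` a finite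
sequence from `M`, that satisfies the Tarskian truth conditions for `(M, ∈, A)`. -/
structure IsTruthPredicate (M A T : ZFSet.{u}) : Prop where
  subset : T ⊆ M
  wellFormed : ∀ t ∈ T, ∃ (n : ℕ) (φ : Fml False n) (a : Fin n → ZFSet.{u}),
    (∀ i, a i ∈ M) ∧ t = ZFSet.pair φ.code (tuple a)
  tarski : TarskiConditions M A False
    (fun _ φ a => ZFSet.pair φ.code (tuple a) ∈ T) (fun _ _ _ => False)

/-- `Θ` is the `Γ`-iterated truth predicate of `M` relative to the class `A`: a class of triples
`(ξ, φ, a)`, with `ξ` in the domain of `Γ`, with `φ` a formula in the language with `∈`, a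
predicate for `A` and the symbol `Θ̂`, and with `a` a finite sequence from `M`, that satisfies at each
level `ξ` the Tarskian truth conditions for `(M, ∈, A)`, where at level `ξ` the formula
`Θ̂(η, ψ, b)` is true if and only if `η < ξ` and `(η, ψ, b) ∈ Θ`. -/
structure IsIteratedTruthPredicate (M Γ A Θ : ZFSet.{u}) : Prop where
  subset : Θ ⊆ M
  wellFormed : ∀ t ∈ Θ, ∃ (ξ : ZFSet.{u}) (n : ℕ) (φ : Fml True n) (a : Fin n → ZFSet.{u}),
    InDom Γ ξ ∧ (∀ i, a i ∈ M) ∧ t = triple ξ φ.code (tuple a)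
  tarski : ∀ ξ : ZFSet.{u}, InDom Γ ξ → TarskiConditions M A True
    (fun _ φ a => triple ξ φ.code (tuple a) ∈ Θ)
    (fun η c b => StrictLT Γ η ξ ∧ triple η c b ∈ Θ)

end ClassTheory

/-! All the required classes already exist among the true subsets of `M`, where `M = V_κ`.
Satisfaction for `(M, ∈, A)` is definable in the ambient universe, and codes and finite sequences
lie in `V_κ`, so `Tr(A)` is a subset of `M`. Since `V_κ` contains all its countable subsets, a class
well-order in the sense of `M` is truly well-founded, and iterated truth is obtained by recursion
along it (`exists_isIteratedTruthPredicate`).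

Now add to `X` the class `C`, one truth predicate for each class and one iterated predicate for each
pair of classes. Because `X` contains every element of `M`, it is infinite and its size does not
change. A Löwenheim–Skolem hull in `(M, P(M))` that contains all sets
(`exists_isElementarySubmodel`) yields `Y`. Comprehension descends to `Y` by elementarity; class
replacement holds for every subset of `V_κ` because `κ` is regular and a strong limit
(`IsGBModel.of_isElementarySubmodel`). -/

namespace ClassTheory

open FirstOrder Cardinal

/-! ### Closure properties of `V_κ` -/

section Universe

variable {κ : Cardinal.{u}}

/-- Regularity: fewer than `κ` ranks below `κ.ord` are bounded below `κ.ord`. -/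
theorem mem_vonNeumann_of_card_lt (hκ : κ.IsInaccessible) {b : ZFSet.{u}}
    (hb : b ⊆ ZFSet.vonNeumann κ.ord) (hc : b.card < κ) : b ∈ ZFSet.vonNeumann κ.ord := by
  -- Indexing by `Shrink` puts the elements of `b` in universe `u`, where the cofinality bound
  -- applies.
  have hr : b = ZFSet.range (fun i : Shrink.{u} b => (((equivShrink b).symm i : b) : ZFSet.{u})) := by
    ext z
    rw [ZFSet.mem_range]
    constructor
    · intro hz
      exact ⟨equivShrink b ⟨z, hz⟩, by simp⟩
    · rintro ⟨i, rfl⟩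
      exact ((equivShrink b).symm i).2
  rw [ZFSet.mem_vonNeumann, hr, ZFSet.rank_range]
  refine Ordinal.iSup_lt_of_lt_cof (by rw [hκ.isRegular.cof_ord]; exact hc) fun i => ?_
  exact (Cardinal.isSuccLimit_ord hκ.aleph0_lt.le).succ_lt
    (ZFSet.mem_vonNeumann.1 (hb ((equivShrink b).symm i).2))

theorem card_lt_of_mem_vonNeumann (hκ : κ.IsInaccessible) {b : ZFSet.{u}}
    (hb : b ∈ ZFSet.vonNeumann κ.ord) : b.card < κ := by
  rw [ZFSet.mem_vonNeumann] at hb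
  calc b.card ≤ (ZFSet.vonNeumann b.rank).card := ZFSet.card_mono (ZFSet.subset_vonNeumann_self b)
    _ = preBeth b.rank := ZFSet.card_vonNeumann _
    _ < preBeth κ.ord := preBeth_strictMono hb
    _ = κ := hκ.preBeth_ord

/-- Serves both finite sequences and the descending sequences that refute ill-foundedness. -/
theorem range_mem_vonNeumann (hκ : κ.IsInaccessible) {α : Type} [Countable α]
    {f : α → ZFSet.{u}} (hf : ∀ i, f i ∈ ZFSet.vonNeumann κ.ord) :
    ZFSet.range f ∈ ZFSet.vonNeumann κ.ord := by
  refine mem_vonNeumann_of_card_lt hκ ?_ ?_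
  · intro z hz
    obtain ⟨i, rfl⟩ := ZFSet.mem_range.1 hz
    exact hf i
  · refine lt_of_le_of_lt ?_ hκ.aleph0_lt
    have h := ZFSet.lift_card_range_le (f := f)
    have h2 : Cardinal.lift.{u} #α ≤ ℵ₀ := by
      rw [Cardinal.lift_le_aleph0]; exact mk_le_aleph0
    simpa using h.trans h2

theorem pair_mem_vonNeumann (hκ : κ.IsInaccessible) {x y : ZFSet.{u}}
    (hx : x ∈ ZFSet.vonNeumann κ.ord) (hy : y ∈ ZFSet.vonNeumann κ.ord) :
    ZFSet.pair x y ∈ ZFSet.vonNeumann κ.ord := by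
  have hl := Cardinal.isSuccLimit_ord hκ.aleph0_lt.le
  rw [ZFSet.mem_vonNeumann] at *
  rw [ZFSet.pair, ZFSet.rank_pair, ZFSet.rank_singleton, ZFSet.rank_pair]
  exact max_lt (hl.succ_lt (hl.succ_lt hx))
    (hl.succ_lt (max_lt (hl.succ_lt hx) (hl.succ_lt hy)))

theorem num_mem_vonNeumann (hκ : κ.IsInaccessible) (n : ℕ) :
    num n ∈ ZFSet.vonNeumann κ.ord := by
  rw [ZFSet.mem_vonNeumann, num, Ordinal.rank_toZFSet, Cardinal.lt_ord]
  simpa using hκ.nat_lt n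

end Universe

/-! ### Codes of formulas and finite sequences -/

theorem num_inj {m n : ℕ} : (num m : ZFSet.{u}) = num n ↔ m = n := by
  simp [num, Ordinal.toZFSet_injective.eq_iff]

theorem Fml.code_injective {θ : Prop} {n : ℕ} {φ ψ : Fml θ n}
    (h : (φ.code : ZFSet.{u}) = ψ.code) : φ = ψ := by
  induction φ <;> cases ψ <;>
    simp_all [Fml.code, triple, ZFSet.pair_inj, num_inj, Fin.val_inj]
  all_goals grind

theorem length_le_of_tuple_eq {m n : ℕ} {a : Fin m → ZFSet.{u}} {b : Fin n → ZFSet.{u}}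
    (h : tuple a = tuple b) : m ≤ n := by
  by_contra! hlt
  have : ZFSet.pair (num n) (a ⟨n, hlt⟩) ∈ tuple b :=
    h ▸ ZFSet.mem_range.2 ⟨⟨n, hlt⟩, rfl⟩
  obtain ⟨j, hj⟩ := ZFSet.mem_range.1 this
  exact j.2.ne (num_inj.1 (ZFSet.pair_inj.1 hj).1)

theorem tuple_injective {n : ℕ} {a b : Fin n → ZFSet.{u}} (h : tuple a = tuple b) : a = b := by
  funext i
  have : ZFSet.pair (num i) (a i) ∈ tuple b := h ▸ ZFSet.mem_range.2 ⟨i, rfl⟩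
  obtain ⟨j, hj⟩ := ZFSet.mem_range.1 this
  obtain ⟨hj, hb⟩ := ZFSet.pair_inj.1 hj
  rw [← hb, Fin.ext (num_inj.1 hj)]

theorem tuple_mem_vonNeumann {κ : Cardinal.{u}} (hκ : κ.IsInaccessible) {n : ℕ}
    {a : Fin n → ZFSet.{u}} (ha : ∀ i, a i ∈ ZFSet.vonNeumann κ.ord) :
    tuple a ∈ ZFSet.vonNeumann κ.ord :=
  range_mem_vonNeumann hκ fun i => pair_mem_vonNeumann hκ (num_mem_vonNeumann hκ _) (ha i)

theorem Fml.code_mem_vonNeumann {κ : Cardinal.{u}} (hκ : κ.IsInaccessible) {θ : Prop} {n : ℕ}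
    (φ : Fml θ n) : φ.code ∈ ZFSet.vonNeumann κ.ord := by
  have hp := fun {x y} => pair_mem_vonNeumann (x := x) (y := y) hκ
  have hn := num_mem_vonNeumann hκ
  induction φ with
  | falsum => exact hp (hn _) (hn _)
  | mem i j => exact hp (hn _) (hp (hn _) (hn _))
  | eq i j => exact hp (hn _) (hp (hn _) (hn _))
  | cls i => exact hp (hn _) (hn _)
  | tr _ i j k => exact hp (hn _) (hp (hn _) (hp (hn _) (hn _)))
  | imp φ ψ hφ hψ => exact hp (hn _) (hp hφ hψ)
  | all φ hφ => exact hp (hn _) (hp (hn _) hφ)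

/-! ### Satisfaction, truth predicates and iterated truth predicates -/

/-- Satisfaction in `(M, ∈, A)`, where the relation `T` interprets the symbol `Θ̂`. -/
def Fml.Sat {θ : Prop} (M A : ZFSet.{u}) (T : ZFSet.{u} → ZFSet.{u} → ZFSet.{u} → Prop) :
    ∀ {n : ℕ}, Fml θ n → (Fin n → ZFSet.{u}) → Prop
  | _, .falsum, _ => False
  | _, .mem i j, a => a i ∈ a j
  | _, .eq i j, a => a i = a j
  | _, .cls i, a => a i ∈ A
  | _, .tr _ i j k, a => T (a i) (a j) (a k)
  | _, .imp φ ψ, a => φ.Sat M A T a → ψ.Sat M A T a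
  | _, .all φ, a => ∀ b ∈ M, φ.Sat M A T (Fin.snoc (α := fun _ => ZFSet.{u}) a b)

theorem tarskiConditions_of_iff_sat {M A : ZFSet.{u}} {θ : Prop}
    {S : ∀ n : ℕ, Fml θ n → (Fin n → ZFSet.{u}) → Prop}
    {T : ZFSet.{u} → ZFSet.{u} → ZFSet.{u} → Prop}
    (h : ∀ (n : ℕ) (φ : Fml θ n) (a : Fin n → ZFSet.{u}), (∀ i, a i ∈ M) →
      (S n φ a ↔ φ.Sat M A T a)) : TarskiConditions M A θ S T where
  falsum n a ha := by simp [h _ _ _ ha, Fml.Sat]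
  mem n a ha i j := by simp [h _ _ _ ha, Fml.Sat]
  eq n a ha i j := by simp [h _ _ _ ha, Fml.Sat]
  cls n a ha i := by simp [h _ _ _ ha, Fml.Sat]
  tr n a ha _ i j k := by simp [h _ _ _ ha, Fml.Sat]
  imp n a ha φ ψ := by simp [h _ _ _ ha, Fml.Sat]
  all n a ha φ := by
    rw [h _ _ _ ha, Fml.Sat]
    refine forall₂_congr fun b hb => (h _ _ _ fun i => ?_).symm
    refine Fin.lastCases ?_ (fun i => ?_) i <;> simp [hb, ha]

/-- The pair `(c, t)` codes a formula and a sequence from `M` that are related by `S`. -/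
def CodedBy (M : ZFSet.{u}) {θ : Prop} (S : ∀ n : ℕ, Fml θ n → (Fin n → ZFSet.{u}) → Prop)
    (c t : ZFSet.{u}) : Prop :=
  ∃ (n : ℕ) (φ : Fml θ n) (a : Fin n → ZFSet.{u}),
    (∀ i, a i ∈ M) ∧ c = φ.code ∧ t = tuple a ∧ S n φ a

/-- A code alone does not determine the number of free variables (consider `falsum`); the length of
the sequence does, so it is recovered first. -/
theorem codedBy_code_tuple {M : ZFSet.{u}} {θ : Prop}
    {S : ∀ n : ℕ, Fml θ n → (Fin n → ZFSet.{u}) → Prop} {n : ℕ} {φ : Fml θ n}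
    {a : Fin n → ZFSet.{u}} (ha : ∀ i, a i ∈ M) :
    CodedBy M S φ.code (tuple a) ↔ S n φ a := by
  refine ⟨?_, fun h => ⟨n, φ, a, ha, rfl, rfl, h⟩⟩
  rintro ⟨m, ψ, b, -, hc, ht, h⟩
  obtain rfl : n = m := (length_le_of_tuple_eq ht).antisymm (length_le_of_tuple_eq ht.symm)
  obtain rfl := tuple_injective ht
  obtain rfl := Fml.code_injective hc
  exact h

theorem exists_isTruthPredicate {κ : Cardinal.{u}} (hκ : κ.IsInaccessible) (A : ZFSet.{u}) :
    ∃ T, IsTruthPredicate (ZFSet.vonNeumann κ.ord) A T := by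
  set M := ZFSet.vonNeumann κ.ord
  let S : ∀ n : ℕ, Fml False n → (Fin n → ZFSet.{u}) → Prop :=
    fun n φ a => φ.Sat M A (fun _ _ _ => False) a
  refine ⟨M.sep fun t => ∃ c s, t = ZFSet.pair c s ∧ CodedBy M S c s, ZFSet.sep_subset, ?_, ?_⟩
  · intro t ht
    obtain ⟨-, c, s, rfl, n, φ, a, ha, rfl, rfl, -⟩ := ZFSet.mem_sep.1 ht
    exact ⟨n, φ, a, ha, rfl⟩
  · refine tarskiConditions_of_iff_sat fun n φ a ha => ?_
    rw [ZFSet.mem_sep]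
    constructor
    · rintro ⟨-, c, s, h, hS⟩
      obtain ⟨rfl, rfl⟩ := ZFSet.pair_inj.1 h
      exact (codedBy_code_tuple ha).1 hS
    · intro h
      exact ⟨pair_mem_vonNeumann hκ (φ.code_mem_vonNeumann hκ) (tuple_mem_vonNeumann hκ ha),
        _, _, rfl, (codedBy_code_tuple ha).2 h⟩

theorem IsClassWellOrder.mem_of_inDom {M Γ x : ZFSet.{u}} (hΓ : IsClassWellOrder M Γ)
    (hM : M.IsTransitive) (hx : InDom Γ x) : x ∈ M := by
  have h : {x} ∈ M := hM.subset_of_mem (hΓ.subset hx) (by simp [ZFSet.pair])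
  exact hM.subset_of_mem h (by simp)

/-- A well-order in the sense of `V_κ` is a well-order: by regularity of `κ`, descending sequences
are sets in `V_κ`. -/
theorem IsClassWellOrder.wellFounded {κ : Cardinal.{u}} (hκ : κ.IsInaccessible) {Γ : ZFSet.{u}}
    (hΓ : IsClassWellOrder (ZFSet.vonNeumann κ.ord) Γ) : WellFounded (StrictLT Γ) := by
  rw [wellFounded_iff_isEmpty_descending_chain]
  refine ⟨fun ⟨f, hf⟩ => ?_⟩
  have hdom : ∀ n, InDom Γ (f n) := fun n => (hΓ.refl _ _ (hf n).1).2
  have hmem : ∀ n, f n ∈ ZFSet.vonNeumann κ.ord := fun n =>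
    hΓ.mem_of_inDom (ZFSet.isTransitive_vonNeumann _) (hdom n)
  obtain ⟨m, hm, hle⟩ := hΓ.least (ZFSet.range f) (range_mem_vonNeumann hκ hmem)
    (fun h => ZFSet.notMem_empty (f 0) (h ▸ ZFSet.mem_range_self 0))
    (fun x hx => by obtain ⟨n, rfl⟩ := ZFSet.mem_range.1 hx; exact hdom n)
  obtain ⟨n, rfl⟩ := ZFSet.mem_range.1 hm
  exact (hf n).2 (hΓ.antisymm _ _ (hf n).1 (hle _ (ZFSet.mem_range_self (f := f) (n + 1))))

/-- The levels of the iterated truth predicate: the codes that are true at level `ξ`. -/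
noncomputable def trueAt (M A : ZFSet.{u}) {Γ : ZFSet.{u}} (wf : WellFounded (StrictLT Γ)) :
    ZFSet.{u} → ZFSet.{u} → ZFSet.{u} → Prop :=
  wf.fix fun ξ rec => CodedBy M (θ := True) fun _ φ a =>
    φ.Sat M A (fun η c t => ∃ h : StrictLT Γ η ξ, rec η h c t) a

theorem exists_isIteratedTruthPredicate {κ : Cardinal.{u}} (hκ : κ.IsInaccessible)
    {Γ : ZFSet.{u}} (hΓ : IsClassWellOrder (ZFSet.vonNeumann κ.ord) Γ) (A : ZFSet.{u}) :
    ∃ Θ, IsIteratedTruthPredicate (ZFSet.vonNeumann κ.ord) Γ A Θ := by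
  have wf := hΓ.wellFounded hκ
  set M := ZFSet.vonNeumann κ.ord
  have hfix : ∀ ξ, trueAt M A wf ξ = CodedBy M (θ := True) fun _ φ a =>
      φ.Sat M A (fun η c t => ∃ _ : StrictLT Γ η ξ, trueAt M A wf η c t) a :=
    fun ξ => wf.fix_eq _ ξ
  let P : ZFSet.{u} → Prop :=
    fun x => ∃ ξ c t, x = triple ξ c t ∧ InDom Γ ξ ∧ trueAt M A wf ξ c t
  have hmem : ∀ ξ c t, InDom Γ ξ → (triple ξ c t ∈ M.sep P ↔ trueAt M A wf ξ c t) := by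
    intro ξ c t hξ
    rw [ZFSet.mem_sep]
    constructor
    · rintro ⟨-, ξ', c', t', h, -, hS⟩
      obtain ⟨rfl, h'⟩ := ZFSet.pair_inj.1 h
      obtain ⟨rfl, rfl⟩ := ZFSet.pair_inj.1 h'
      exact hS
    · intro h
      refine ⟨?_, _, _, _, rfl, hξ, h⟩
      rw [hfix] at h
      obtain ⟨n, φ, a, ha, rfl, rfl, -⟩ := h
      exact pair_mem_vonNeumann hκ (hΓ.mem_of_inDom (ZFSet.isTransitive_vonNeumann _) hξ)
        (pair_mem_vonNeumann hκ (φ.code_mem_vonNeumann hκ) (tuple_mem_vonNeumann hκ ha))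
  refine ⟨M.sep P, ZFSet.sep_subset, ?_,
    fun ξ hξ => tarskiConditions_of_iff_sat fun n φ a ha => ?_⟩
  · intro x hx
    obtain ⟨-, ξ, c, t, rfl, hξ, h⟩ := ZFSet.mem_sep.1 hx
    rw [hfix] at h
    obtain ⟨n, φ, a, ha, rfl, rfl, -⟩ := h
    exact ⟨ξ, n, φ, a, hξ, ha, rfl⟩
  · rw [hmem _ _ _ hξ, hfix, codedBy_code_tuple ha]
    -- The recursion and the truth clause guard lower levels differently; they agree because `η < ξ`
    -- already puts `η` in the domain.
    have : (fun η c t => ∃ _ : StrictLT Γ η ξ, trueAt M A wf η c t) = fun η c t =>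
        StrictLT Γ η ξ ∧ triple η c t ∈ M.sep P := by
      funext η c t
      rw [exists_prop]
      exact propext (and_congr_right fun h => (hmem _ _ _ (hΓ.refl _ _ h.1).1).symm)
    rw [this]

/-! ### Elementary submodels of the full second-order model -/

theorem card_classLang_le_aleph0 : classLang.card ≤ ℵ₀ := by
  have : ∀ l, Countable (classLang.Relations l) := fun l =>
    have : Subsingleton (ClassRel l) := ⟨fun a b => by cases a <;> cases b <;> rfl⟩
    inferInstanceAs (Countable (ClassRel l))
  have : ∀ l, Countable (classLang.Functions l) := fun l => inferInstanceAs (Countable Empty)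
  have : Countable classLang.Symbols := inferInstanceAs (Countable (_ ⊕ _))
  exact mk_le_aleph0

theorem Carrier.incl_injective {M : ZFSet.{u}} {X Y : Set ZFSet.{u}} (h : X ⊆ Y) :
    Function.Injective (Carrier.incl (M := M) h) := by
  rintro (x | x) (y | y) hxy
  · exact congrArg Sum.inl (Sum.inl_injective hxy)
  · cases hxy
  · cases hxy
  · have hxy := Subtype.ext_iff.1 (Sum.inr_injective hxy)
    exact congrArg Sum.inr (Subtype.ext hxy)

theorem Carrier.isSet_incl {M : ZFSet.{u}} {X Y : Set ZFSet.{u}} (h : X ⊆ Y) (x : Carrier M X) :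
    (Carrier.incl h x).IsSet ↔ x.IsSet := by
  cases x <;> rfl

theorem Carrier.mem_incl {M : ZFSet.{u}} {X Y : Set ZFSet.{u}} (h : X ⊆ Y) (x y : Carrier M X) :
    (Carrier.incl h x).Mem (Carrier.incl h y) ↔ x.Mem y := by
  cases x <;> cases y <;> rfl

/-- The inclusion `(M, X) → (M, Y)`, as an embedding of structures. -/
def Carrier.inclEmbedding {M : ZFSet.{u}} {X Y : Set ZFSet.{u}} (h : X ⊆ Y) :
    Carrier M X ↪[classLang] Carrier M Y where
  toFun := Carrier.incl h
  inj' := Carrier.incl_injective h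
  map_fun' := fun f => Empty.elim f
  map_rel' := fun r v => by
    cases r
    · exact Carrier.isSet_incl h (v 0)
    · exact Carrier.mem_incl h (v 0) (v 1)

/-- Löwenheim–Skolem for class models: every infinite collection of at least `|M|` classes is
contained in an elementary submodel of `(M, Z)` of the same cardinality. -/
theorem exists_isElementarySubmodel {M : ZFSet.{u}} {X Z : Set ZFSet.{u}} (hXZ : X ⊆ Z)
    (hinf : ℵ₀ ≤ #X) (hM : #{x // x ∈ M} ≤ #X) :
    ∃ Y, X ⊆ Y ∧ IsElementarySubmodel M Y Z ∧ #Y = #X := by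
  -- The hull is started from all sets as well as from `X`, so it can omit only classes.
  let s : Set (Carrier M Z) := Set.range (Carrier.incl (M := M) hXZ)
  have hs : #s = #X := by
    rw [mk_range_eq _ (Carrier.incl_injective hXZ)]
    change #(_ ⊕ _) = _
    rw [mk_sum, lift_id, lift_id]
    exact add_eq_right hinf hM
  obtain ⟨S, hsS, hS⟩ := Language.exists_elementarySubstructure_card_eq classLang s #X hinf
    (by simp [hs]) (by
      exact (lift_le_aleph0.2 card_classLang_le_aleph0).trans (by simpa using hinf))
    (by
      rw [lift_id, lift_id, ← hs]
      exact mk_set_le s)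
  rw [lift_id, lift_id] at hS
  have hsets : ∀ x, Sum.inl x ∈ S := fun x => hsS ⟨Sum.inl x, rfl⟩
  -- As `S` contains every set, it is a copy of `(M, Y)` for the classes `Y` it retains.
  let Y : Set ZFSet.{u} := {A | ∃ h : A ∈ Z, (Sum.inr ⟨A, h⟩ : Carrier M Z) ∈ S}
  have hYZ : Y ⊆ Z := fun A hA => hA.1
  have hXY : X ⊆ Y := fun A hA => ⟨hXZ hA, hsS ⟨Sum.inr ⟨A, hA⟩, rfl⟩⟩
  have hY : ∀ x, Carrier.incl (M := M) hYZ x ∈ S := by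
    rintro (x | A)
    · exact hsets x
    · exact A.2.2
  have hsurj : ∀ x ∈ S, ∃ y, Carrier.incl (M := M) hYZ y = x := by
    rintro (x | A) hx
    · exact ⟨Sum.inl x, rfl⟩
    · exact ⟨Sum.inr ⟨A.1, A.2, hx⟩, rfl⟩
  refine ⟨Y, hXY, ⟨hYZ, ?_⟩, le_antisymm ?_ (mk_le_mk_of_subset hXY)⟩
  · let e : Carrier M Y ≃[classLang] S :=
      { Equiv.ofBijective (fun x => (⟨Carrier.incl hYZ x, hY x⟩ : S))
          ⟨fun x y h => Carrier.incl_injective hYZ (congrArg Subtype.val h),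
            fun ⟨x, hx⟩ => by
              obtain ⟨y, rfl⟩ := hsurj x hx
              exact ⟨y, rfl⟩⟩ with
        map_fun' := fun f => Empty.elim f
        map_rel' := fun r v => (Carrier.inclEmbedding (M := M) hYZ).map_rel r v }
    exact ⟨S.subtype.comp e.toElementaryEmbedding, rfl⟩
  · rw [← hS]
    exact mk_le_of_injective (f := fun A : Y => (⟨Sum.inr ⟨A.1, hYZ A.2⟩, A.2.2⟩ : S))
      fun A B h => Subtype.ext (by
        simpa using Sum.inr_injective (congrArg Subtype.val h))

/-- Every instance of comprehension passes to elementary submodels of the full model. -/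
theorem IsElementarySubmodel.comprehension {M : ZFSet.{u}} {Y : Set ZFSet.{u}}
    (hY : IsElementarySubmodel M Y (fullClasses M)) {n : ℕ}
    (φ : classLang.BoundedFormula (Fin n) 1) (v : Fin n → Carrier M Y) :
    ∃ A ∈ Y, ∀ (x : ZFSet.{u}) (hx : x ∈ M),
      x ∈ A ↔ φ.Realize v (fun _ => Carrier.ofSet x hx) := by
  obtain ⟨h, f, hf⟩ := hY
  let isSet (i : Fin 2) : classLang.BoundedFormula (Fin n) 2 :=
    .rel (L := classLang) ClassRel.isSet ![.var (Sum.inr i)]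
  -- The comprehension instance itself, with a class quantifier: variable 0 is the class and
  -- variable 1 its candidate element, to which `relabel` shifts the variable of `φ`. The clause on
  -- the sort of variable 0 may stand under the universal quantifier since the domain is nonempty.
  let ψ : classLang.BoundedFormula (Fin n) 0 :=
    .ex (.all (∼(isSet 0) ⊓ (isSet 1 ⟹
      ((Language.BoundedFormula.rel (L := classLang) ClassRel.mem
        ![.var (Sum.inr 1), .var (Sum.inr 0)]) ⇔
          (φ.relabel (Sum.inl : Fin n → Fin n ⊕ Fin 1) :
            classLang.BoundedFormula (Fin n) (1 + 1))))))
  have key : ∀ {Z : Set ZFSet.{u}} (w : Fin n → Carrier M Z), ψ.Realize w default ↔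
      ∃ A : Carrier M Z, ∀ x : Carrier M Z, ¬ A.IsSet ∧
        (x.IsSet → (x.Mem A ↔ φ.Realize w fun _ => x)) := by
    intro Z w
    simp only [ψ, isSet, Language.BoundedFormula.realize_ex, Language.BoundedFormula.realize_all,
      Language.BoundedFormula.realize_inf, Language.BoundedFormula.realize_not,
      Language.BoundedFormula.realize_imp, Language.BoundedFormula.realize_iff,
      Language.BoundedFormula.realize_relabel]
    refine exists_congr fun A => forall_congr' fun x => and_congr Iff.rfl
      (imp_congr Iff.rfl (iff_congr Iff.rfl ?_))
    have : (Fin.snoc (Fin.snoc default A) x : Fin 2 → Carrier M Z) ∘ Fin.natAdd 1 =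
        fun _ : Fin 1 => x := by
      funext i
      obtain rfl := Subsingleton.elim i 0
      rfl
    exact iff_of_eq (congrArg (φ.Realize w) this)
  -- In the full model, separation in the ambient universe supplies the class.
  have hfull : ψ.Realize (f ∘ v) default := by
    let A := M.sep fun x => ∃ hx : x ∈ M, φ.Realize (f ∘ v) (fun _ => Carrier.ofSet x hx)
    have hA : ∀ x (hx : x ∈ M), x ∈ A ↔ φ.Realize (f ∘ v) (fun _ => Carrier.ofSet x hx) :=
      fun x hx => ZFSet.mem_sep.trans ⟨fun h => h.2.2, fun h => ⟨hx, hx, h⟩⟩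
    refine (key _).2 ⟨Carrier.ofClass A ZFSet.sep_subset, ?_⟩
    rintro (⟨x, hx⟩ | B)
    · exact ⟨id, fun _ => hA x hx⟩
    · exact ⟨id, fun h => h.elim⟩
  have hψ : ψ.Realize v default := (f.map_formula ψ v).1 hfull
  obtain ⟨A | A, hA⟩ := (key v).1 hψ
  · exact absurd trivial (hA (Sum.inl A)).1
  · exact ⟨A.1, A.2, fun x hx => (hA (Carrier.ofSet x hx)).2 trivial⟩

/-- Comprehension with `x` as a set parameter returns `x` as a class, by transitivity of `M`. This
gives `|M| ≤ |X|`. -/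
theorem IsGBModel.mem_of_mem {M : ZFSet.{u}} {X : Set ZFSet.{u}} (hX : IsGBModel M X)
    {x : ZFSet.{u}} (hx : x ∈ M) : x ∈ X := by
  obtain ⟨A, hA, h⟩ := hX.comprehension 1
    (.rel (L := classLang) ClassRel.mem ![.var (Sum.inr 0), .var (Sum.inl 0)]) (.rel _ _)
    (fun _ => Carrier.ofSet x hx)
  have hxM := hX.transitive.subset_of_mem hx
  have h' : ∀ y ∈ M, y ∈ A ↔ y ∈ x := fun y hy => h y hy
  obtain rfl : A = x := ZFSet.ext fun y =>
    ⟨fun hy => (h' y (hX.class_subset A hA hy)).1 hy, fun hy => (h' y (hxM hy)).2 hy⟩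
  exact hA

/-- The set axioms mention only `M` and carry over from `X`; replacement and comprehension need
arguments. -/
theorem IsGBModel.of_isElementarySubmodel {κ : Cardinal.{u}} (hκ : κ.IsInaccessible)
    {X Y : Set ZFSet.{u}} (hX : IsGBModel (ZFSet.vonNeumann κ.ord) X)
    (hY : IsElementarySubmodel (ZFSet.vonNeumann κ.ord) Y
      (fullClasses (ZFSet.vonNeumann κ.ord))) :
    IsGBModel (ZFSet.vonNeumann κ.ord) Y where
  transitive := hX.transitive
  class_subset := hY.1
  extensionality := hX.extensionality
  foundation := hX.foundation
  pairing := hX.pairing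
  union := hX.union
  powerset := hX.powerset
  infinity := hX.infinity
  choice := hX.choice
  class_extensionality A hA B hB h := ZFSet.ext fun x =>
    ⟨fun hx => (h x (hY.1 hA hx)).1 hx, fun hx => (h x (hY.1 hB hx)).2 hx⟩
  class_replacement F _ hfun a ha := by
    set M := ZFSet.vonNeumann κ.ord
    let b := M.sep fun y => ∃ x ∈ M, x ∈ a ∧ ZFSet.pair x y ∈ F
    refine ⟨b, mem_vonNeumann_of_card_lt hκ ZFSet.sep_subset
      (lt_of_le_of_lt ?_ (card_lt_of_mem_vonNeumann hκ ha)), fun y hy => ?_⟩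
    · have hb : ∀ y : b, ∃ x ∈ M, x ∈ a ∧ ZFSet.pair x y ∈ F := fun y => (ZFSet.mem_sep.1 y.2).2
      -- Choosing preimages injects `b` into `a`, as `F` is single-valued; hence `|b| ≤ |a| < κ`.
      choose g hgM hga hgF using hb
      rw [← Cardinal.lift_le.{u + 1}, ← ZFSet.cardinalMk_coe_sort, ← ZFSet.cardinalMk_coe_sort]
      refine mk_le_of_injective (f := fun y => (⟨g y, hga y⟩ : a)) fun y z h => Subtype.ext ?_
      have h : g y = g z := congrArg Subtype.val h
      exact hfun _ (hgM y) _ (ZFSet.mem_sep.1 y.2).1 _ (ZFSet.mem_sep.1 z.2).1 (hgF y) (h ▸ hgF z)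
    · rw [ZFSet.mem_sep]
      constructor
      · exact fun h => h.2
      · exact fun h => ⟨hy, h⟩
  comprehension _ φ _ v := hY.comprehension φ v

end ClassTheory

/-! ### Assembling the extension. -/

theorem mainTheorem12 (κ : Cardinal.{u}) (hκ : κ.IsInaccessible) (M : ZFSet.{u})
    (hM : M = ZFSet.vonNeumann κ.ord) (X : Set ZFSet.{u}) (hX : ClassTheory.IsGBModel M X)
    (C : ZFSet.{u}) (hC : ClassTheory.IsCohenGeneric M X C) :
    ∃ Y : Set ZFSet.{u},
      X ⊆ Y ∧
      ClassTheory.IsGBModel M Y ∧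
      C ∈ Y ∧
      (∀ A ∈ X, ∃ T ∈ Y, ClassTheory.IsTruthPredicate M A T) ∧
      (∀ ξ ∈ X, ClassTheory.IsClassWellOrder M ξ →
        ∀ A ∈ X, ∃ Θ ∈ Y, ClassTheory.IsIteratedTruthPredicate M ξ A Θ) ∧
      ClassTheory.IsElementarySubmodel M Y (ClassTheory.fullClasses M) ∧
      Cardinal.mk Y = Cardinal.mk X := by
  open ClassTheory Cardinal in
  subst hM
  set M := ZFSet.vonNeumann κ.ord
  have hMX : #{x // x ∈ M} ≤ #X :=
    mk_le_of_injective (f := fun x : {x // x ∈ M} => (⟨x.1, hX.mem_of_mem x.2⟩ : X))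
      fun x y h => Subtype.ext (by simpa using h)
  have hinf : ℵ₀ ≤ #X := by
    have h : lift.{u + 1} #ℕ ≤ lift.{0} #{x // x ∈ M} :=
      lift_mk_le_lift_mk_of_injective
        (f := fun n => (⟨num n, num_mem_vonNeumann hκ n⟩ : {x // x ∈ M}))
        fun m n h => num_inj.1 (congrArg Subtype.val h)
    exact (by simpa using h : ℵ₀ ≤ #{x // x ∈ M}).trans hMX
  choose T hT using exists_isTruthPredicate hκ
  -- The default value `∅` makes `Θ` total on pairs while keeping its values subsets of `M`.
  have hΘ : ∀ p : ZFSet.{u} × ZFSet.{u}, ∃ Θ, Θ ⊆ M ∧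
      (IsClassWellOrder M p.1 → IsIteratedTruthPredicate M p.1 p.2 Θ) := fun p => by
    by_cases hp : IsClassWellOrder M p.1
    · obtain ⟨Θ, h⟩ := exists_isIteratedTruthPredicate hκ hp p.2
      exact ⟨Θ, h.subset, fun _ => h⟩
    · exact ⟨∅, ZFSet.empty_subset _, fun h => absurd h hp⟩
  choose Θ hΘM hΘ using hΘ
  let X' : Set ZFSet.{u} := ((X ∪ {C}) ∪ T '' X) ∪ Θ '' (X ×ˢ X)
  have hX' : X' ⊆ fullClasses M := by
    rintro A (((hA | rfl) | ⟨A, -, rfl⟩) | ⟨p, -, rfl⟩)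
    · exact hX.class_subset A hA
    · exact fun x hx => (hC.1 x hx).1
    · exact (hT A).subset
    · exact hΘM p
  have hXX' : X ⊆ X' := fun A hA => Or.inl (Or.inl (Or.inl hA))
  -- The iterated predicates are indexed by `X ×ˢ X`, and `|X|² = |X|` for infinite `X`.
  have hcard : #X' = #X := by
    refine le_antisymm ?_ (mk_le_mk_of_subset hXX')
    refine (mk_union_le _ _).trans (add_le_of_le hinf ((mk_union_le _ _).trans (add_le_of_le hinf
      ((mk_union_le _ _).trans (add_le_of_le hinf le_rfl ?_)) mk_image_le)) ?_)
    · rw [mk_singleton]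
      exact one_le_aleph0.trans hinf
    · refine mk_image_le.trans ?_
      rw [mk_setProd, mul_eq_self hinf]
  obtain ⟨Y, hX'Y, hY, hYcard⟩ := exists_isElementarySubmodel (M := M) hX'
    (hcard.symm ▸ hinf) (hcard.symm ▸ hMX)
  exact ⟨Y, hXX'.trans hX'Y, hX.of_isElementarySubmodel hκ hY,
    hX'Y (Or.inl (Or.inl (Or.inr rfl))),
    fun A hA => ⟨T A, hX'Y (Or.inl (Or.inr ⟨A, hA, rfl⟩)), hT A⟩,
    fun ξ hξ hwo A hA => ⟨Θ (ξ, A), hX'Y (Or.inr ⟨(ξ, A), ⟨hξ, hA⟩, rfl⟩), hΘ (ξ, A) hwo⟩,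
    hY, hYcard.trans hcard⟩
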